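/- For a metric space $(X,d)$ and functions $f,g$ from a common set $S$ to $X$ write $\rho(f,g)=\sup_{x\in S}d(f(x),g(x))\in[0,\infty]$, with value $0$ if $S=\emptyset$. A metric space $X$ is \emph{perturbable} if for every $\epsilon>0$ there exists $\delta>0$ such that for every continuous $f:X\to X$, every finite subset $F\subseteq X$ and every function $g_0:F\to X$ with $\rho(g_0,f|_F)<\delta$, there exists a continuous $g:X\to X$ with $\rho(f,g)<\epsilon$ and $g|_F=g_0$. A \emph{c-structure} on a topological space $X$ is a function $F$ from the set of nonempty finite subsets of $X$ to the collection of nonempty contractible subspaces of $X$ such that $A\subseteq B$ implies $F(A)\subseteq F(B)$. A nonempty subset $E\subseteq X$ is an \emph{$F$-set} if $F(A)\subseteq E$ for every nonempty finite $A\subseteq E$. The space $X$ with the c-structure $F$ is an \emph{m.c.-space} if each point of $X$ has a neighborhood base consisting of $F$-sets. \textbf{Proposition.} Let $X$ be a compact metric space. If $X$ is totally disconnected, or has a c-structure which makes it an m.c.-space, then $X$ is perturbable. -/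

import Mathlib

open Set Filter Topology
open scoped ENNReal

/-- The supremum metric `ρ(f, g) = sup_x d(f x, g x)` of two functions into a metric space, with
value in `[0, ∞]`, so that an unbounded pair of functions is at distance `∞`. -/
noncomputable def supDist {α X : Type*} [MetricSpace X] (f g : α → X) : ℝ≥0∞ :=
  ⨆ x, edist (f x) (g x)

/-- Perturbable metric spaces. (For `F = ∅` the condition holds trivially, with `g = f`.) -/
def IsPerturbable (X : Type*) [MetricSpace X] : Prop :=
  ∀ ε : ℝ, 0 < ε → ∃ δ : ℝ, 0 < δ ∧
    ∀ f : X → X, Continuous f →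
      ∀ (F : Finset X) (g₀ : F → X),
        supDist g₀ (fun x : F => f x) < ENNReal.ofReal δ →
          ∃ g : X → X, Continuous g ∧ supDist f g < ENNReal.ofReal ε ∧ ∀ x : F, g x = g₀ x

/-- A c-structure on a topological space: a monotone function from the nonempty finite subsets to
the nonempty contractible subspaces. The value of `toFun` at `∅` is never used. -/
structure CStructure (X : Type*) [TopologicalSpace X] where
  toFun : Finset X → Set X
  nonempty : ∀ A : Finset X, A.Nonempty → (toFun A).Nonempty
  contractible : ∀ A : Finset X, A.Nonempty → ContractibleSpace (toFun A)
  mono : ∀ A B : Finset X, A.Nonempty → A ⊆ B → toFun A ⊆ toFun B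

/-- A nonempty set `E` is an `F`-set if `F(A) ⊆ E` for all finite nonempty `A ⊆ E`. -/
def CStructure.IsFSet {X : Type*} [TopologicalSpace X] (F : CStructure X) (E : Set X) : Prop :=
  E.Nonempty ∧ ∀ A : Finset X, A.Nonempty → (A : Set X) ⊆ E → F.toFun A ⊆ E

/-- `F` makes `X` an m.c.-space: each point has a neighborhood base consisting of `F`-sets
(neighborhoods are not required to be open). -/
def CStructure.IsMCSpace {X : Type*} [TopologicalSpace X] (F : CStructure X) : Prop :=
  ∀ x : X, (𝓝 x).HasBasis (fun E : Set X => E ∈ 𝓝 x ∧ F.IsFSet E) id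

/-! In the m.c. case, take `F` together with a fine net as vertices `i`, with values `y i` near `f
i` that equal `g₀` on `F`. Continuous weights `φ x` are supported on vertices near `x`, and at `p ∈
F` on `p` alone. A map `h` on unnormalised barycentric coordinates, built over skeleta by
contracting the sets `C.toFun (σ.image y)`, gives `g = h ∘ φ`. Compactness puts the relevant `y i`
in a small `F`-set around `f x`, so `g x` lies there too; at `p` the value is forced because
`C.toFun {y} ⊆ {y}`. In the totally disconnected case, `f` is replaced by constants on small clopen
sets. -/

/-- The contraction of a contractible subspace `S`, written as a map with parameter in `ℝ`: it is
the identity of `S` at parameter `0` and constant for parameters `≥ 1`. -/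
theorem exists_contraction {X : Type*} [TopologicalSpace X] (S : Set X) (hS : ContractibleSpace S) :
    ∃ (H : ℝ → X → X) (c : X), c ∈ S ∧
      ContinuousOn (fun p : ℝ × X => H p.1 p.2) (univ ×ˢ S) ∧
      (∀ s, ∀ x ∈ S, H s x ∈ S) ∧ (∀ x ∈ S, H 0 x = x) ∧ (∀ s, 1 ≤ s → ∀ x, H s x = c) := by
  classical
  obtain ⟨c, ⟨K⟩⟩ := id_nullhomotopic S
  refine ⟨fun s x => if hx : x ∈ S then (K (projIcc 0 1 zero_le_one s, ⟨x, hx⟩) : X) else c, c,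
    c.2, ?_, ?_, ?_, ?_⟩
  · rw [continuousOn_iff_continuous_domRestrict]
    have : Continuous fun p : ((univ : Set ℝ) ×ˢ S : Set (ℝ × X)) =>
        (K (projIcc (0 : ℝ) 1 zero_le_one p.1.1, ⟨p.1.2, p.2.2⟩) : X) := by
      refine continuous_subtype_val.comp (K.continuous.comp (Continuous.prodMk ?_ ?_))
      · exact continuous_projIcc.comp (continuous_fst.comp continuous_subtype_val)
      · exact (continuous_snd.comp continuous_subtype_val).subtype_mk _
    refine this.congr fun p => ?_
    have hp : p.1.2 ∈ S := p.2.2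
    simp [hp]
  · intro s x hx
    simp [hx]
  · intro x hx
    simp [hx]
  · intro s hs x
    have : projIcc (0 : ℝ) 1 zero_le_one s = 1 := projIcc_of_right_le _ hs
    by_cases hx : x ∈ S <;> simp [hx, this]

/-! ### Maps on cones over the faces of a simplex -/

/-- The cone over the face `σ` of the standard simplex, without its apex. -/
def openCone {ι : Type*} (σ : Finset ι) : Set (ι → ℝ) :=
  {t | (∀ i, 0 ≤ t i) ∧ t ≠ 0 ∧ ∀ i, i ∉ σ → t i = 0}

theorem openCone_mono {ι : Type*} {σ τ : Finset ι} (h : σ ⊆ τ) : openCone σ ⊆ openCone τ :=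
  fun _ ht => ⟨ht.1, ht.2.1, fun i hi => ht.2.2 i fun hi' => hi (h hi')⟩

/-- Cones are closed away from the origin, so finitely many of them glue like closed sets. -/
theorem mem_openCone_of_mem_closure {ι : Type*} {σ : Finset ι} {t : ι → ℝ}
    (ht : t ∈ closure (openCone σ)) (h0 : t ≠ 0) : t ∈ openCone σ := by
  have hc : IsClosed {t : ι → ℝ | (∀ i, 0 ≤ t i) ∧ ∀ i, i ∉ σ → t i = 0} := by
    simp only [ofPred_and, ofPred_forall]
    refine (isClosed_iInter fun i => isClosed_le continuous_const (continuous_apply i)).inter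
      (isClosed_iInter fun i => isClosed_iInter fun _ =>
        isClosed_eq (continuous_apply i) continuous_const)
  have := closure_minimal (s := openCone σ)
    (t := {t : ι → ℝ | (∀ i, 0 ≤ t i) ∧ ∀ i, i ∉ σ → t i = 0})
    (fun t ht => ⟨ht.1, ht.2.2⟩) hc ht
  exact ⟨this.1, h0, this.2⟩

/-- Continuity on finitely many cones glues. -/
theorem continuousOn_iUnion_openCone {ι X : Type*} [Finite ι] [TopologicalSpace X]
    {h : (ι → ℝ) → X} {K : Set (Finset ι)} (hK : ∀ σ ∈ K, ContinuousOn h (openCone σ)) :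
    ContinuousOn h (⋃ σ ∈ K, openCone σ) := by
  intro t ht
  have h0 : t ≠ 0 := by
    simp only [mem_iUnion] at ht
    obtain ⟨σ, _, hσ⟩ := ht
    exact hσ.2.1
  rw [ContinuousWithinAt, nhdsWithin_biUnion K.toFinite]
  simp only [tendsto_iSup]
  intro σ hσ
  by_cases htσ : t ∈ openCone σ
  · exact hK σ hσ t htσ
  · have : 𝓝[openCone σ] t = ⊥ := by
      rw [← notMem_closure_iff_nhdsWithin_eq_bot]
      exact fun hc => htσ (mem_openCone_of_mem_closure hc h0)
    rw [this]
    exact tendsto_bot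

/-- Induction over the skeleta of a simplex: for a monotone assignment `G` of contractible
subspaces to faces, there is a continuous map sending the interior of each face into its value. -/
theorem exists_continuousOn_skeleton {ι X : Type*} [Fintype ι] [DecidableEq ι] [TopologicalSpace X]
    [Nonempty X]
    (G : Finset ι → Set X) (hG : ∀ σ, σ.Nonempty → ContractibleSpace (G σ))
    (hmono : ∀ σ τ, σ.Nonempty → σ ⊆ τ → G σ ⊆ G τ) (k : ℕ) :
    ∃ h : (ι → ℝ) → X, ∀ σ : Finset ι, σ.card ≤ k → ContinuousOn h (openCone σ) ∧
      ∀ t ∈ openCone σ, (∀ i ∈ σ, t i ≠ 0) → h t ∈ G σ := by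
  have hne : ∀ (σ : Finset ι), ∀ t ∈ openCone σ, σ.Nonempty := by
    intro σ t ht
    by_contra hσ
    rw [Finset.not_nonempty_iff_eq_empty] at hσ
    exact ht.2.1 (funext fun i => ht.2.2 i (by simp [hσ]))
  induction k with
  | zero =>
    refine ⟨fun _ => Classical.arbitrary X, fun σ _ => ⟨continuousOn_const, fun t ht _ => ?_⟩⟩
    have := (hne σ t ht).card_pos
    omega
  | succ k ih =>
    obtain ⟨h, hh⟩ := ih
    have hex : ∀ σ : Finset ι, ∃ (H : ℝ → X → X) (c : X), σ.Nonempty → c ∈ G σ ∧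
        ContinuousOn (fun p : ℝ × X => H p.1 p.2) (univ ×ˢ G σ) ∧
        (∀ s, ∀ x ∈ G σ, H s x ∈ G σ) ∧ (∀ x ∈ G σ, H 0 x = x) ∧
        (∀ s, 1 ≤ s → ∀ x, H s x = c) := by
      intro σ
      by_cases hσ : σ.Nonempty
      · obtain ⟨H, c, hHc⟩ := exists_contraction (G σ) (hG σ hσ)
        exact ⟨H, c, fun _ => hHc⟩
      · exact ⟨fun _ x => x, Classical.arbitrary X, fun h => absurd h hσ⟩
    choose H c hH using hex
    let supp : (ι → ℝ) → Finset ι := fun t => Finset.univ.filter fun i => t i ≠ 0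
    have hsupp : ∀ σ, ∀ t ∈ openCone σ, supp t ⊆ σ := by
      intro σ t ht i hi
      by_contra hiσ
      exact (Finset.mem_filter.1 hi).2 (ht.2.2 i hiσ)
    have hcone : ∀ σ, ∀ t ∈ openCone σ, t ∈ openCone (supp t) := fun σ t ht =>
      ⟨ht.1, ht.2.1, fun i hi => by simpa [supp] using hi⟩
    have hmem : ∀ σ, ∀ t ∈ openCone σ, (supp t).card ≤ k → h t ∈ G σ := by
      intro σ t ht hk
      have := (hh (supp t) hk).2 t (hcone σ t ht) fun i hi => (Finset.mem_filter.1 hi).2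
      exact hmono _ _ (hne _ t (hcone σ t ht)) (hsupp σ t ht) this
    -- The least coordinate `m` vanishes exactly on the boundary of the cone over a face;
    -- subtracting it pushes `t` onto that boundary. Without normalisation no division is needed.
    let m : Finset ι → (ι → ℝ) → ℝ := fun σ t =>
      if hσ : σ.Nonempty then σ.inf' hσ t else 0
    let r : Finset ι → (ι → ℝ) → ι → ℝ := fun σ t i => if i ∈ σ then t i - m σ t else 0
    have hmcont : ∀ σ, Continuous (m σ) := by
      intro σ
      by_cases hσ : σ.Nonempty
      · simp only [m, hσ, dite_true]
        exact Continuous.finset_inf'_apply hσ fun i _ => continuous_apply i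
      · simp only [m, hσ, dite_false]
        exact continuous_const
    have hrcont : ∀ σ, Continuous (r σ) := by
      intro σ
      refine continuous_pi fun i => ?_
      by_cases hi : i ∈ σ
      · simp only [r, hi, if_true]
        exact (continuous_apply i).sub (hmcont σ)
      · simp only [r, hi, if_false]
        exact continuous_const
    have hm_le : ∀ σ t, ∀ i ∈ σ, m σ t ≤ t i := by
      intro σ t i hi
      have hσ : σ.Nonempty := ⟨i, hi⟩
      simp only [m, hσ, dite_true]
      exact Finset.inf'_le _ hi
    have hm_ex : ∀ σ t, σ.Nonempty → ∃ i ∈ σ, m σ t = t i := by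
      intro σ t hσ
      simp only [m, hσ, dite_true]
      exact Finset.exists_mem_eq_inf' hσ t
    have hm_nonneg : ∀ σ, ∀ t ∈ openCone σ, 0 ≤ m σ t := by
      intro σ t ht
      obtain ⟨i, _, hi⟩ := hm_ex σ t (hne σ t ht)
      rw [hi]
      exact ht.1 i
    have hr_mem : ∀ σ, ∀ t ∈ openCone σ, 2 * m σ t ≤ ‖t‖ → r σ t ∈ openCone σ := by
      intro σ t ht hle
      refine ⟨fun i => ?_, fun h0 => ?_, fun i hi => by simp [r, hi]⟩
      · by_cases hi : i ∈ σ
        · simpa [r, hi] using hm_le σ t i hi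
        · simp [r, hi]
      -- If `r σ t = 0`, all coordinates on `σ` equal `m σ t`, which is then the sup norm of `t`,
      -- against `2 * m σ t ≤ ‖t‖`.
      · have hpos : 0 < ‖t‖ := norm_pos_iff.2 ht.2.1
        have : ‖t‖ ≤ m σ t := by
          refine (pi_norm_le_iff_of_nonneg (hm_nonneg σ t ht)).2 fun i => ?_
          rw [Real.norm_of_nonneg (ht.1 i)]
          by_cases hi : i ∈ σ
          · have := congrFun h0 i
            simp only [r, hi, if_true, Pi.zero_apply] at this
            linarith
          · rw [ht.2.2 i hi]
            exact hm_nonneg σ t ht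
        linarith
    have hr_card : ∀ σ, σ.card ≤ k + 1 → ∀ t ∈ openCone σ, 2 * m σ t ≤ ‖t‖ →
        (supp (r σ t)).card ≤ k := by
      intro σ hσk t ht hle
      obtain ⟨i, hiσ, hi⟩ := hm_ex σ t (hne σ t ht)
      have : supp (r σ t) ⊂ σ := by
        refine (Finset.ssubset_iff_of_subset (hsupp σ _ (hr_mem σ t ht hle))).2 ⟨i, hiσ, ?_⟩
        simp [supp, r, hiσ, hi]
      have := Finset.card_lt_card this
      omega
    have hcontk : ContinuousOn h (⋃ σ ∈ {σ : Finset ι | σ.card ≤ k}, openCone σ) :=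
      continuousOn_iUnion_openCone fun σ hσ => (hh σ hσ).1
    -- The parameter is 0 on the boundary, where `E` extends `h`, and reaches 1 while `r σ t` is
    -- still nonzero; beyond that `E` is constant, whatever `h (r σ t)` is.
    let E : Finset ι → (ι → ℝ) → X := fun σ t => H σ (2 * m σ t / ‖t‖) (h (r σ t))
    have hE_mem : ∀ σ, σ.card ≤ k + 1 → ∀ t ∈ openCone σ, E σ t ∈ G σ := by
      intro σ hσk t ht
      obtain ⟨hc, -, hHG, -, hH1⟩ := hH σ (hne σ t ht)
      have hpos : 0 < ‖t‖ := norm_pos_iff.2 ht.2.1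
      by_cases hle : 2 * m σ t ≤ ‖t‖
      · exact hHG _ _ (hmem σ _ (hr_mem σ t ht hle) (hr_card σ hσk t ht hle))
      · simp only [E]
        rw [hH1 _ ((one_le_div hpos).2 (not_le.1 hle).le)]
        exact hc
    have hE_eq : ∀ σ, ∀ t ∈ openCone σ, supp t ≠ σ → (supp t).card ≤ k → E σ t = h t := by
      intro σ t ht hs hk
      have hm0 : m σ t = 0 := by
        obtain ⟨i, hiσ, hi⟩ := Finset.exists_of_ssubset
          (Finset.ssubset_iff_subset_ne.2 ⟨hsupp σ t ht, hs⟩)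
        have hti : t i = 0 := by simpa [supp] using hi
        exact le_antisymm (hti ▸ hm_le σ t i hiσ) (hm_nonneg σ t ht)
      have hrt : r σ t = t := by
        funext i
        by_cases hi : i ∈ σ
        · simp [r, hi, hm0]
        · simp [r, hi, ht.2.2 i hi]
      obtain ⟨-, -, -, hH0, -⟩ := hH σ (hne σ t ht)
      simp only [E, hm0, hrt, mul_zero, zero_div]
      exact hH0 _ (hmem σ t ht hk)
    have hE_cont : ∀ σ, σ.card ≤ k + 1 → ContinuousOn (E σ) (openCone σ) := by
      intro σ hσk
      have hsplit : openCone σ = (openCone σ ∩ {t | 2 * m σ t ≤ ‖t‖}) ∪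
          (openCone σ ∩ {t | ‖t‖ ≤ 2 * m σ t}) := by
        rw [← inter_union_distrib_left, eq_comm, inter_eq_left]
        exact fun t _ => le_total (2 * m σ t) ‖t‖
      have hcl1 : IsClosed {t : ι → ℝ | 2 * m σ t ≤ ‖t‖} :=
        isClosed_le (continuous_const.mul (hmcont σ)) continuous_norm
      have hcl2 : IsClosed {t : ι → ℝ | ‖t‖ ≤ 2 * m σ t} :=
        isClosed_le continuous_norm (continuous_const.mul (hmcont σ))
      have hc1 : ContinuousOn (E σ) (openCone σ ∩ {t | 2 * m σ t ≤ ‖t‖}) := by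
        rcases σ.eq_empty_or_nonempty with rfl | hσ
        · exact fun t ht => absurd (hne _ t ht.1) (by simp)
        obtain ⟨-, hHc, -, -, -⟩ := hH σ hσ
        refine hHc.comp (f := fun t => (2 * m σ t / ‖t‖, h (r σ t))) (ContinuousOn.prodMk ?_ ?_) ?_
        · exact (continuous_const.mul (hmcont σ)).continuousOn.div continuous_norm.continuousOn
            fun t ht => (norm_pos_iff.2 ht.1.2.1).ne'
        · refine hcontk.comp (hrcont σ).continuousOn fun t ht => ?_
          simp only [mem_iUnion]
          exact ⟨supp (r σ t), hr_card σ hσk t ht.1 ht.2, hcone σ _ (hr_mem σ t ht.1 ht.2)⟩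
        · exact fun t ht => ⟨mem_univ _,
            hmem σ _ (hr_mem σ t ht.1 ht.2) (hr_card σ hσk t ht.1 ht.2)⟩
      have hc2 : ContinuousOn (E σ) (openCone σ ∩ {t | ‖t‖ ≤ 2 * m σ t}) := by
        refine (continuousOn_const (c := c σ)).congr fun t ht => ?_
        have hpos : 0 < ‖t‖ := norm_pos_iff.2 ht.1.2.1
        exact (hH σ (hne σ t ht.1)).2.2.2.2 _ ((one_le_div hpos).2 ht.2) _
      intro t ht
      rw [hsplit]
      refine ContinuousWithinAt.union ?_ ?_
      · by_cases h1 : t ∈ {t : ι → ℝ | 2 * m σ t ≤ ‖t‖}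
        · exact hc1 t ⟨ht, h1⟩
        · have : 𝓝[openCone σ ∩ {t : ι → ℝ | 2 * m σ t ≤ ‖t‖}] t = ⊥ := by
            rw [← notMem_closure_iff_nhdsWithin_eq_bot]
            exact fun hc => h1 (closure_minimal inter_subset_right hcl1 hc)
          rw [ContinuousWithinAt, this]
          exact tendsto_bot
      · by_cases h1 : t ∈ {t : ι → ℝ | ‖t‖ ≤ 2 * m σ t}
        · exact hc2 t ⟨ht, h1⟩
        · have : 𝓝[openCone σ ∩ {t : ι → ℝ | ‖t‖ ≤ 2 * m σ t}] t = ⊥ := by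
            rw [← notMem_closure_iff_nhdsWithin_eq_bot]
            exact fun hc => h1 (closure_minimal inter_subset_right hcl2 hc)
          rw [ContinuousWithinAt, this]
          exact tendsto_bot
    refine ⟨fun t => if (supp t).card ≤ k then h t else E (supp t) t, fun σ hσ => ?_⟩
    by_cases hσk : σ.card ≤ k
    · have hcard : ∀ t ∈ openCone σ, (supp t).card ≤ k := fun t ht =>
        (Finset.card_le_card (hsupp σ t ht)).trans hσk
      refine ⟨(hh σ hσk).1.congr fun t ht => if_pos (hcard t ht), fun t ht _ => ?_⟩
      simp only [if_pos (hcard t ht)]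
      exact hmem σ t ht (hcard t ht)
    · have hval : ∀ t ∈ openCone σ,
          (if (supp t).card ≤ k then h t else E (supp t) t) = E σ t := by
        intro t ht
        by_cases hs : supp t = σ
        · rw [hs, if_neg hσk]
        · have : (supp t).card < σ.card := Finset.card_lt_card
            (Finset.ssubset_iff_subset_ne.2 ⟨hsupp σ t ht, hs⟩)
          have hk : (supp t).card ≤ k := by omega
          rw [if_pos hk, hE_eq σ t ht hs hk]
      refine ⟨(hE_cont σ hσ).congr hval, fun t ht _ => ?_⟩
      simp only [hval t ht]
      exact hE_mem σ hσ t ht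

/-! ### Compact m.c.-spaces -/

/-- Any `z ≠ y` is missed by some `F`-set neighbourhood of `y`, which contains `C.toFun {y}`. -/
theorem CStructure.IsMCSpace.toFun_singleton {X : Type*} [TopologicalSpace X] [T1Space X]
    {C : CStructure X} (hC : C.IsMCSpace) (y : X) : C.toFun {y} ⊆ {y} := by
  intro z hz
  by_contra hzy
  obtain ⟨E, ⟨hE, hF⟩, hsub⟩ := (hC y).mem_iff.1 (isOpen_compl_singleton.mem_nhds
    (show y ∈ ({z}ᶜ : Set X) from fun h => hzy h.symm))
  exact hsub (hF.2 {y} (Finset.singleton_nonempty y) (by simpa using mem_of_mem_nhds hE) hz) rfl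

/-- On a compact m.c.-space small balls are uniformly contained in small `F`-sets. -/
theorem CStructure.IsMCSpace.exists_ball_subset {X : Type*} [MetricSpace X] [CompactSpace X]
    {C : CStructure X} (hC : C.IsMCSpace) {ε : ℝ} (hε : 0 < ε) :
    ∃ δ > 0, ∀ y : X, ∃ E, C.IsFSet E ∧ Metric.ball y δ ⊆ E ∧ ∀ z ∈ E, dist y z < ε := by
  have hex : ∀ x : X, ∃ E, (E ∈ 𝓝 x ∧ C.IsFSet E) ∧ E ⊆ Metric.ball x (ε / 2) := fun x =>
    (hC x).mem_iff.1 (Metric.ball_mem_nhds x (half_pos hε))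
  choose E hE hEb using hex
  obtain ⟨δ, hδ, hL⟩ := lebesgue_number_lemma_of_metric (s := univ) (c := fun x => interior (E x))
    isCompact_univ (fun x => isOpen_interior)
    (fun x _ => mem_iUnion.2 ⟨x, mem_interior_iff_mem_nhds.2 (hE x).1⟩)
  refine ⟨δ, hδ, fun y => ?_⟩
  obtain ⟨x, hx⟩ := hL y (mem_univ y)
  have hsub := hx.trans interior_subset
  refine ⟨E x, (hE x).2, hsub, fun z hz => ?_⟩
  have h1 := Metric.mem_ball.1 (hEb x (hsub (Metric.mem_ball_self hδ)))
  have h2 := Metric.mem_ball.1 (hEb x hz)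
  have := dist_triangle_right y z x
  linarith

theorem dist_lt_of_supDist_lt {α X : Type*} [MetricSpace X] {f g : α → X} {δ : ℝ}
    (h : supDist f g < ENNReal.ofReal δ) (x : α) : dist (f x) (g x) < δ := by
  have h1 : edist (f x) (g x) < ENNReal.ofReal δ :=
    (le_iSup (fun x => edist (f x) (g x)) x).trans_lt h
  rw [edist_dist] at h1
  exact (ENNReal.ofReal_lt_ofReal_iff_of_nonneg dist_nonneg).1 h1

theorem supDist_lt_of_dist_lt {α X : Type*} [MetricSpace X] {f g : α → X} {ε : ℝ} (hε : 0 < ε)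
    (h : ∀ x, dist (f x) (g x) < ε / 2) : supDist f g < ENNReal.ofReal ε := by
  refine (iSup_le fun x => ?_ : supDist f g ≤ ENNReal.ofReal (ε / 2)).trans_lt
    ((ENNReal.ofReal_lt_ofReal_iff hε).2 (half_lt_self hε))
  rw [edist_dist]
  exact ENNReal.ofReal_le_ofReal (h x).le

theorem CStructure.IsMCSpace.isPerturbable {X : Type*} [MetricSpace X] [CompactSpace X]
    {C : CStructure X} (hC : C.IsMCSpace) : IsPerturbable X := by
  classical
  intro ε hε
  obtain ⟨δ, hδ, hball⟩ := hC.exists_ball_subset (half_pos hε)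
  -- Half of `δ` bounds the distance from `y i` to `f i`, the other half the oscillation of `f`.
  refine ⟨δ / 2, half_pos hδ, fun f hf F g₀ hg₀ => ?_⟩
  rcases isEmpty_or_nonempty X with hX | hX
  · exact ⟨f, hf, supDist_lt_of_dist_lt hε fun x => isEmptyElim x, fun x => isEmptyElim x.1⟩
  obtain ⟨η, hη, hfη⟩ := Metric.uniformContinuous_iff.1
    (CompactSpace.uniformContinuous_of_continuous hf) (δ / 2) (half_pos hδ)
  obtain ⟨T, -, hTfin, hT⟩ := finite_cover_balls_of_compact (isCompact_univ (X := X)) hη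
  let S : Finset X := F ∪ hTfin.toFinset
  let y : S → X := fun i => if hi : i.1 ∈ F then g₀ ⟨i, hi⟩ else f i
  have hy : ∀ i : S, dist (y i) (f i) < δ / 2 := by
    intro i
    by_cases hi : i.1 ∈ F
    · simpa only [y, hi, dite_true] using dist_lt_of_supDist_lt hg₀ ⟨i.1, hi⟩
    · simpa [y, hi] using hδ
  -- The first factor confines the support to the `η`-ball of `i`; the product kills the weight at
  -- every point of `F` other than `i`.
  let φ : X → S → ℝ := fun x i => max 0 (η - dist x i) * ∏ p ∈ F.erase i.1, dist x p
  have hφc : Continuous φ := by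
    refine continuous_pi fun i => ?_
    simp only [φ]
    fun_prop
  have hφ0 : ∀ x i, 0 ≤ φ x i := fun x i =>
    mul_nonneg (le_max_left _ _) (Finset.prod_nonneg fun p _ => dist_nonneg)
  have hφpos : ∀ (x : X) (i : S), dist x i.1 < η → (∀ p ∈ F.erase i.1, x ≠ p) → φ x i ≠ 0 := by
    intro x i hd hp
    refine mul_ne_zero (lt_max_of_lt_right (sub_pos.2 hd)).ne' ?_
    exact Finset.prod_ne_zero_iff.2 fun p hpF => dist_ne_zero.2 (hp p hpF)
  have hφF : ∀ p ∈ F, ∀ i : S, i.1 ≠ p → φ p i = 0 := by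
    intro p hp i hi
    refine mul_eq_zero_of_right _ (Finset.prod_eq_zero (i := p) ?_ (dist_self p))
    exact Finset.mem_erase.2 ⟨hi.symm, hp⟩
  have hφd : ∀ (x : X) (i : S), φ x i ≠ 0 → dist x i.1 < η := by
    intro x i hi
    by_contra hd
    refine hi (mul_eq_zero_of_left (max_eq_left ?_) _)
    linarith
  have hφne : ∀ x, ∃ i, φ x i ≠ 0 := by
    intro x
    by_cases hx : x ∈ F
    · refine ⟨⟨x, Finset.mem_union_left _ hx⟩, hφpos x _ ((dist_self x).trans_lt hη) fun p hp => ?_⟩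
      exact (Finset.ne_of_mem_erase hp).symm
    · have := hT (mem_univ x)
      simp only [mem_iUnion] at this
      obtain ⟨i, hiT, hi⟩ := this
      refine ⟨⟨i, Finset.mem_union_right _ (hTfin.mem_toFinset.2 hiT)⟩, hφpos x _ (Metric.mem_ball.1 hi) ?_⟩
      rintro p hp rfl
      exact hx (Finset.mem_of_mem_erase hp)
  obtain ⟨h, hh⟩ := exists_continuousOn_skeleton (fun σ : Finset S => C.toFun (σ.image y))
    (fun σ hσ => C.contractible _ (hσ.image y))
    (fun σ τ hσ hστ => C.mono _ _ (hσ.image y) (Finset.image_subset_image hστ))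
    (Finset.univ : Finset S).card
  have hmem : ∀ x, φ x ∈ openCone (Finset.univ.filter fun i => φ x i ≠ 0) := fun x =>
    ⟨hφ0 x, fun h0 => (hφne x).elim fun i hi => hi (congrFun h0 i), fun i hi => by simpa using hi⟩
  have hval : ∀ x, h (φ x) ∈ C.toFun ((Finset.univ.filter fun i => φ x i ≠ 0).image y) := fun x =>
    (hh _ (Finset.card_le_card (Finset.subset_univ _))).2 _ (hmem x)
      fun i hi => (Finset.mem_filter.1 hi).2
  refine ⟨fun x => h (φ x), ?_, supDist_lt_of_dist_lt hε fun x => ?_, fun p => ?_⟩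
  · exact (hh Finset.univ le_rfl).1.comp_continuous hφc
      fun x => openCone_mono (Finset.subset_univ _) (hmem x)
  · obtain ⟨E, hE, hsub, hEd⟩ := hball (f x)
    refine hEd _ (hE.2 _ ?_ ?_ (hval x))
    · obtain ⟨i, hi⟩ := hφne x
      exact ⟨y i, Finset.mem_image_of_mem y (by simpa using hi)⟩
    · intro z hz
      obtain ⟨i, hi, rfl⟩ := Finset.mem_image.1 (Finset.mem_coe.1 hz)
      refine hsub (Metric.mem_ball.2 ?_)
      have h1 := hfη (hφd x i (Finset.mem_filter.1 hi).2)
      have h2 := dist_triangle_right (y i) (f x) (f i)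
      have h3 := hy i
      linarith
  · have hpS : p.1 ∈ S := Finset.mem_union_left _ p.2
    have himg : (Finset.univ.filter fun i => φ p i ≠ 0).image y ⊆ {g₀ p} := by
      intro z hz
      obtain ⟨i, hi, rfl⟩ := Finset.mem_image.1 hz
      have hip : i.1 = p.1 := by
        by_contra hne
        exact (Finset.mem_filter.1 hi).2 (hφF p p.2 i hne)
      have : i = ⟨p.1, hpS⟩ := Subtype.ext hip
      subst this
      simp [y]
    obtain ⟨i, hi⟩ := hφne p
    exact hC.toFun_singleton _ (C.mono _ _ ⟨y i, Finset.mem_image_of_mem y (by simpa using hi)⟩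
      himg (hval p))

/-! ### Totally disconnected spaces -/

/-- Finitely many values of a continuous map can be perturbed on small clopen sets. -/
theorem exists_continuous_eqOn_finset {X : Type*} [MetricSpace X] [CompactSpace X]
    [TotallyDisconnectedSpace X] {δ : ℝ} (hδ : 0 < δ) {f : X → X} (hf : Continuous f)
    (F : Finset X) (u : X → X) (hu : ∀ x ∈ F, dist (u x) (f x) < δ) :
    ∃ g : X → X, Continuous g ∧ (∀ x, dist (f x) (g x) < 2 * δ) ∧ ∀ x ∈ F, g x = u x := by
  classical
  induction F using Finset.induction_on with
  | empty => exact ⟨f, hf, fun x => by simpa using hδ, by simp⟩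
  | insert a F ha ih =>
    obtain ⟨g, hg, hfg, hgu⟩ := ih fun x hx => hu x (Finset.mem_insert_of_mem hx)
    -- `V` avoids `F`, so earlier values survive. On `V` the new value is compared with `f` itself,
    -- so errors do not accumulate.
    obtain ⟨V, hV, haV, hVsub⟩ := compact_exists_isClopen_in_isOpen
      (((Metric.isOpen_ball (x := f a) (ε := δ)).preimage hf).inter
        F.finite_toSet.isClosed.isOpen_compl)
      (⟨Metric.mem_ball_self hδ, by simpa using ha⟩ : a ∈ f ⁻¹' Metric.ball (f a) δ ∩ (↑F)ᶜ)
    refine ⟨V.piecewise (fun _ => u a) g, ?_, fun x => ?_, fun x hx => ?_⟩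
    · exact continuous_const.piecewise (by simp [hV.frontier_eq]) hg
    · by_cases hx : x ∈ V
      · rw [piecewise_eq_of_mem _ _ _ hx]
        have h1 : dist (f x) (f a) < δ := (hVsub hx).1
        have h2 := hu a (Finset.mem_insert_self a F)
        have h3 := dist_triangle_right (f x) (u a) (f a)
        linarith
      · rw [piecewise_eq_of_notMem _ _ _ hx]
        exact hfg x
    · rcases Finset.mem_insert.1 hx with rfl | hxF
      · exact piecewise_eq_of_mem _ _ _ haV
      · rw [piecewise_eq_of_notMem _ _ _ fun hxV => (hVsub hxV).2 hxF]
        exact hgu x hxF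

theorem isPerturbable_of_totallyDisconnectedSpace {X : Type*} [MetricSpace X] [CompactSpace X]
    [TotallyDisconnectedSpace X] : IsPerturbable X := by
  classical
  intro ε hε
  refine ⟨ε / 4, by positivity, fun f hf F g₀ hg₀ => ?_⟩
  obtain ⟨g, hg, hfg, hgu⟩ := exists_continuous_eqOn_finset (by positivity : 0 < ε / 4) hf F
    (fun x => if hx : x ∈ F then g₀ ⟨x, hx⟩ else x) fun x hx => by
      simpa only [hx, dite_true] using dist_lt_of_supDist_lt hg₀ ⟨x, hx⟩
  refine ⟨g, hg, supDist_lt_of_dist_lt hε fun x => (hfg x).trans_eq (by ring), fun x => ?_⟩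
  simpa using hgu x x.2

theorem mainTheorem4 {X : Type*} [MetricSpace X] [CompactSpace X]
    (h : TotallyDisconnectedSpace X ∨ ∃ F : CStructure X, F.IsMCSpace) :
    IsPerturbable X := by
  rcases h with h | ⟨C, hC⟩
  · exact isPerturbable_of_totallyDisconnectedSpace
  · exact hC.isPerturbable
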